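/- Let $R$ be a (commutative) Dedekind domain such that $\mathrm{Spec}(R)$ is countable, and let $M$ be an $R$-module. Call $M$ \emph{Mittag-Leffler} if for each family $(N_i \mid i\in I)$ of $R$-modules the canonical map $M\otimes_R \prod_{i\in I} N_i \to \prod_{i\in I} (M\otimes_R N_i)$ is injective, and call $M$ \emph{$\aleph_1$-projective} if each countably generated submodule of $M$ is projective. Then $M$ is flat and Mittag-Leffler if and only if $M$ is $\aleph_1$-projective. -/

import Mathlib

universe u v w

/-- A module `M` is *Mittag-Leffler* if for each family of modules `(N i)` the canonical map
`M ⊗ ∏ i, N i → ∏ i, M ⊗ N i`, `x ⊗ n ↦ (x ⊗ n i)_i`, is injective. The families range over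
a universe containing (a copy of) the universe of the ring, and `w` is arbitrary otherwise. -/
def IsMittagLefflerModule (R : Type u) [CommRing R] (M : Type v) [AddCommGroup M]
    [Module R M] : Prop :=
  ∀ (ι : Type (max u w)) (N : ι → Type (max u w)) [∀ i, AddCommGroup (N i)]
    [∀ i, Module R (N i)],
    Function.Injective (TensorProduct.piRightHom R R M N)

/-- A flat Mittag-Leffler module. -/
def IsFlatMittagLefflerModule (R : Type u) [CommRing R] (M : Type v) [AddCommGroup M]
    [Module R M] : Prop :=
  Module.Flat R M ∧ IsMittagLefflerModule.{u, v, w} R M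

/-- A submodule that is generated by a countable (possibly finite) set. -/
def IsCountablyGeneratedSubmodule {R : Type u} [CommRing R] {M : Type v} [AddCommGroup M]
    [Module R M] (C : Submodule R M) : Prop :=
  ∃ s : Set M, s.Countable ∧ Submodule.span R s = C

/-- A module (over a hereditary ring) is *`ℵ₁`-projective* if each countably generated
submodule is projective. -/
def IsAlephOneProjective (R : Type u) [CommRing R] (M : Type v) [AddCommGroup M]
    [Module R M] : Prop :=
  ∀ C : Submodule R M, IsCountablyGeneratedSubmodule C → Module.Projective R C

/-! For torsion-free `M`, both properties are equivalent to `HasFGTorsionClosures`. Finitely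
generated torsion-free modules over `R` are projective, and torsion-free modules are flat. So a
finitely generated torsion closure `P` is projective and pure in `M`: the Mittag-Leffler property
passes from the `P`'s to `M`, and a countably generated submodule is the union of a chain with
projective successive quotients. Conversely, testing the Mittag-Leffler map on one product of
quotients of `R^n` puts a whole torsion closure inside the span of finitely many elements. If `M` is
`ℵ₁`-projective, countability of the spectrum makes closures countably generated, hence projective,
and a projective module that is torsion modulo a finitely generated submodule is finitely generated.
-/

open TensorProduct DirectSum

/-! ### Torsion closures -/

section TorsionClosure

variable {R : Type u} [CommRing R] [IsDomain R] {M : Type v} [AddCommGroup M] [Module R M]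

/-- The submodule of all elements having a nonzero multiple in `F`. -/
def Submodule.torsionClosure (F : Submodule R M) : Submodule R M where
  carrier := {m | ∃ r : R, r ≠ 0 ∧ r • m ∈ F}
  zero_mem' := ⟨1, one_ne_zero, by simp⟩
  add_mem' := by
    rintro a b ⟨r, hr, ha⟩ ⟨s, hs, hb⟩
    refine ⟨r * s, mul_ne_zero hr hs, ?_⟩
    rw [smul_add]
    refine F.add_mem ?_ ?_
    · rw [mul_comm, mul_smul]
      exact F.smul_mem _ ha
    · rw [mul_smul]
      exact F.smul_mem _ hb
  smul_mem' := by
    rintro c a ⟨r, hr, ha⟩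
    exact ⟨r, hr, by rw [smul_comm]; exact F.smul_mem _ ha⟩

namespace Submodule

variable {F G : Submodule R M}

theorem mem_torsionClosure {m : M} : m ∈ F.torsionClosure ↔ ∃ r : R, r ≠ 0 ∧ r • m ∈ F :=
  Iff.rfl

theorem le_torsionClosure : F ≤ F.torsionClosure :=
  fun m hm => ⟨1, one_ne_zero, by simpa using hm⟩

theorem torsionClosure_mono (h : F ≤ G) : F.torsionClosure ≤ G.torsionClosure :=
  fun _ ⟨r, hr, hm⟩ => ⟨r, hr, h hm⟩

theorem mem_torsionClosure_of_smul_mem {r : R} (hr : r ≠ 0) {m : M}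
    (h : r • m ∈ F.torsionClosure) : m ∈ F.torsionClosure := by
  obtain ⟨s, hs, h⟩ := h
  exact ⟨s * r, mul_ne_zero hs hr, by rwa [mul_smul]⟩

theorem isTorsionFree_quotient_of_smul_mem {A : Submodule R M}
    (hA : ∀ (r : R) (m : M), r ≠ 0 → r • m ∈ A → m ∈ A) : Module.IsTorsionFree R (M ⧸ A) := by
  rw [Module.isTorsionFree_iff_smul_eq_zero]
  intro r x hx
  induction x using Submodule.Quotient.induction_on with | _ m =>
  by_cases hr : r = 0
  · exact Or.inl hr
  · right
    rw [← Submodule.Quotient.mk_smul, Submodule.Quotient.mk_eq_zero] at hx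
    rw [Submodule.Quotient.mk_eq_zero]
    exact hA r m hr hx

instance isTorsionFree_quotient_torsionClosure :
    Module.IsTorsionFree R (M ⧸ F.torsionClosure) :=
  isTorsionFree_quotient_of_smul_mem fun _ _ hr h => mem_torsionClosure_of_smul_mem hr h

theorem torsionClosure_bot [Module.IsTorsionFree R M] :
    (⊥ : Submodule R M).torsionClosure = ⊥ := by
  rw [eq_bot_iff]
  rintro m ⟨r, hr, hm⟩
  exact (smul_eq_zero_iff_right hr).1 ((Submodule.mem_bot R).1 hm)

end Submodule

/-- The torsion closure of every finitely generated submodule is finitely generated. -/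
def HasFGTorsionClosures (R : Type u) [CommRing R] [IsDomain R] (M : Type v) [AddCommGroup M]
    [Module R M] : Prop :=
  ∀ F : Submodule R M, F.FG → F.torsionClosure.FG

end TorsionClosure

/-! ### Dual bases and tensor products with direct products -/

theorem Module.exists_dual_basis (R : Type u) [CommRing R] (M : Type v) [AddCommGroup M]
    [Module R M] [Module.Finite R M] [Module.Projective R M] :
    ∃ (n : ℕ) (q : Fin n → M) (φ : Fin n → M →ₗ[R] R), ∀ m, m = ∑ k, φ k m • q k := by
  obtain ⟨n, f, g, -, -, h⟩ := Module.Finite.exists_comp_eq_id_of_projective R M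
  refine ⟨n, fun k => f (Pi.single k 1), fun k => LinearMap.proj k ∘ₗ g, fun m => ?_⟩
  conv_lhs => rw [← LinearMap.id_apply (R := R) m, ← h, LinearMap.comp_apply,
    pi_eq_sum_univ' (g m), map_sum]
  refine Finset.sum_congr rfl fun k _ => ?_
  rw [map_smul]
  congr 2

section piRightHom

variable {R : Type*} [CommRing R] {M P : Type*} [AddCommGroup M] [Module R M] [AddCommGroup P]
  [Module R P] {ι : Type*} {N : ι → Type*} [∀ i, AddCommGroup (N i)] [∀ i, Module R (N i)]

theorem TensorProduct.piRightHom_rTensor (f : P →ₗ[R] M) (z : P ⊗[R] (∀ i, N i)) (i : ι) :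
    piRightHom R R M N (f.rTensor _ z) i = f.rTensor (N i) (piRightHom R R P N z i) := by
  induction z using TensorProduct.induction_on with
  | zero => simp
  | tmul p n => simp
  | add a b ha hb => simp only [map_add, Pi.add_apply, ha, hb]

theorem TensorProduct.lid_rTensor_apply_pi (φ : P →ₗ[R] R) (z : P ⊗[R] (∀ i, N i)) (i : ι) :
    TensorProduct.lid R _ (φ.rTensor _ z) i =
      TensorProduct.lid R _ (φ.rTensor (N i) (piRightHom R R P N z i)) := by
  induction z using TensorProduct.induction_on with
  | zero => simp
  | tmul p n => simp
  | add a b ha hb => simp only [map_add, Pi.add_apply, ha, hb]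

/-- Through a dual basis of `P`, vanishing in `P ⊗ A` reduces to vanishing of the coordinates in
`A`. -/
theorem TensorProduct.eq_sum_tmul_lid_rTensor {A : Type*} [AddCommGroup A] [Module R A] {n : ℕ}
    {q : Fin n → P} {φ : Fin n → P →ₗ[R] R} (h : ∀ p, p = ∑ k, φ k p • q k) (z : P ⊗[R] A) :
    z = ∑ k, q k ⊗ₜ TensorProduct.lid R A ((φ k).rTensor A z) := by
  induction z using TensorProduct.induction_on with
  | zero => simp
  | tmul p a =>
    conv_lhs => rw [h p, TensorProduct.sum_tmul]
    simp [TensorProduct.smul_tmul]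
  | add a b ha hb =>
    conv_lhs => rw [ha, hb]
    simp only [map_add, TensorProduct.tmul_add, Finset.sum_add_distrib]

end piRightHom

/-! ### Mittag-Leffler modules and torsion closures -/

section Dedekind

variable {R : Type u} [CommRing R] [IsDedekindDomain R] {M : Type v} [AddCommGroup M] [Module R M]

theorem Module.projective_of_finite_of_isTorsionFree [Module.Finite R M]
    [Module.IsTorsionFree R M] : Module.Projective R M :=
  have := Module.finitePresentation_of_finite R M
  Module.Flat.projective_of_finitePresentation

theorem hasFGTorsionClosures_of_isMittagLefflerModule [Module.Flat R M]
    (h : IsMittagLefflerModule.{u, v, w} R M) : HasFGTorsionClosures R M := by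
  intro F hF
  obtain ⟨n, e, rfl⟩ := Submodule.fg_iff_exists_fin_generating_family.1 hF
  set F := Submodule.span R (Set.range e)
  let ν (D : Submodule R (Fin n → R)) (j : Fin n) : ULift.{w} ((Fin n → R) ⧸ D) :=
    ULift.up (D.mkQ (Pi.single j 1))
  have hν (D : Submodule R (Fin n → R)) (c : Fin n → R) :
      ∑ j, c j • ν D j = 0 ↔ c ∈ D := by
    rw [← Submodule.Quotient.mk_eq_zero D, ← Submodule.mkQ_apply]
    have : ∑ j, c j • ν D j =
        (ULift.moduleEquiv (R := R) (M := (Fin n → R) ⧸ D)).symm (D.mkQ c) := by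
      conv_rhs => rw [pi_eq_sum_univ' c, map_sum, map_sum]
      refine Finset.sum_congr rfl fun k _ => ?_
      rw [map_smul, map_smul]
      congr 3
    rw [this, LinearEquiv.map_eq_zero_iff]
  -- One product over all `D` for which `∑ e j ⊗ ν D j` vanishes: the equational criterion then
  -- yields a single finite family `y`, with coefficient columns `a · k` lying in every such `D`.
  let I := ULift.{w} {D : Submodule R (Fin n → R) // VanishesTrivially R (ν D) e}
  let N (i : I) : Type (max u w) := ULift.{w} ((Fin n → R) ⧸ i.down.1)
  let μ (j : Fin n) (i : I) : N i := ν i.down.1 j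
  have h0 : ∑ j, e j ⊗ₜ[R] μ j = 0 := by
    apply h I N
    rw [map_sum, map_zero]
    funext i
    have hi := sum_tmul_eq_zero_of_vanishesTrivially R i.down.2
    have hi := congrArg (TensorProduct.comm R _ _) hi
    rw [map_sum, map_zero] at hi
    simpa using hi
  have h1 : ∑ j, μ j ⊗ₜ[R] e j = 0 := by
    have := congrArg (TensorProduct.comm R _ _) h0
    rw [map_sum, map_zero] at this
    simpa using this
  obtain ⟨l, a, y, hy, ha⟩ := vanishesTrivially_of_sum_tmul_eq_zero_of_rTensor_injective R
    (Module.Flat.rTensor_preserves_injective_linearMap _ (Submodule.subtype_injective _)) h1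
  suffices F.torsionClosure ≤ Submodule.span R (Set.range y) from
    Submodule.FG.of_le (Submodule.fg_span (Set.finite_range y)) this
  rintro q ⟨r, hr, hq⟩
  let Q : Submodule R M := F ⊔ Submodule.span R {q}
  have hQ : Module.Finite R Q := Module.Finite.iff_fg.2 (hF.sup (Submodule.fg_span_singleton q))
  have : Module.Projective R Q := Module.projective_of_finite_of_isTorsionFree
  obtain ⟨m, b, φ, hb⟩ := Module.exists_dual_basis R (M := Q)
  let e' (j : Fin n) : Q :=
    ⟨e j, Submodule.mem_sup_left (Submodule.subset_span (Set.mem_range_self j))⟩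
  -- The vectors `(ψ (e' j))_j` for `ψ` in the dual of `Q`. A dual basis of `Q` shows that this `D`
  -- occurs in the product, so each column of `a` comes from a functional on `Q`.
  let D : Submodule R (Fin n → R) :=
    LinearMap.range (LinearMap.pi fun j => LinearMap.applyₗ (R := R) (M₂ := R) (e' j))
  have hD : VanishesTrivially R (ν D) e := by
    refine ⟨m, fun j k => φ k (e' j), fun k => b k, fun j => ?_, fun k => ?_⟩
    · simpa using congrArg (Submodule.subtype Q) (hb (e' j))
    · rw [hν]
      exact ⟨φ k, rfl⟩
  have hψ (k : Fin l) : ∃ ψ : Q →ₗ[R] R, ∀ j, ψ (e' j) = a j k := by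
    have h2 := congrFun (ha k) (ULift.up ⟨D, hD⟩)
    have h3 : ∑ j, a j k • ν D j = 0 := by
      simpa [μ, Finset.sum_apply] using h2
    rw [hν] at h3
    obtain ⟨ψ, hψ⟩ := h3
    exact ⟨ψ, fun j => congrFun hψ j⟩
  choose ψ hψ using hψ
  let θ : Q →ₗ[R] M := ∑ k, (ψ k).smulRight (y k)
  have hθ (x : M) (hx : x ∈ F) : θ ⟨x, Submodule.mem_sup_left hx⟩ = x := by
    induction hx using Submodule.span_induction with
    | mem x hx =>
      obtain ⟨j, rfl⟩ := hx
      change θ (e' j) = e j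
      rw [hy j]
      simp [θ, hψ]
    | zero => exact map_zero θ
    | add x y hx hy h h' =>
      conv_rhs => rw [← h, ← h', ← map_add]
      rfl
    | smul c x hx h =>
      conv_rhs => rw [← h, ← map_smul]
      rfl
  have hqQ : q ∈ Q := Submodule.mem_sup_right (Submodule.mem_span_singleton_self q)
  -- `θ` is the identity on `F`, which contains `r • q`, and `M` is torsion-free.
  have h4 : θ ⟨q, hqQ⟩ = q := by
    have := hθ _ hq
    apply (smul_right_injective M hr)
    change r • θ ⟨q, hqQ⟩ = r • q
    rw [← map_smul]
    exact this
  rw [← h4]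
  simp only [θ, LinearMap.sum_apply, LinearMap.smulRight_apply]
  exact Submodule.sum_mem _ fun k _ => Submodule.smul_mem _ _ (Submodule.subset_span ⟨k, rfl⟩)

theorem isMittagLefflerModule_of_hasFGTorsionClosures [Module.IsTorsionFree R M]
    (h : HasFGTorsionClosures R M) : IsMittagLefflerModule.{u, v, w} R M := by
  intro ι N _ _
  rw [injective_iff_map_eq_zero]
  intro x hx
  obtain ⟨F, hF, x, rfl⟩ := TensorProduct.exists_of_fg x
  set P := F.torsionClosure
  have hP : Module.Finite R P := Module.Finite.iff_fg.2 (h F hF)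
  have : Module.Projective R P := Module.projective_of_finite_of_isTorsionFree
  obtain ⟨m, b, φ, hb⟩ := Module.exists_dual_basis R (M := P)
  -- Purity of `P`: the quotient `M ⧸ P` is torsion-free, hence flat.
  have hinj (A : Type (max u w)) [AddCommGroup A] [Module R A] :
      Function.Injective (P.subtype.rTensor A) := by
    have := LinearMap.lTensor_injective_of_exact_of_flat P.mkQ P.mkQ_surjective P.subtype
      P.subtype_injective (LinearMap.exact_subtype_mkQ P) A
    rwa [← LinearMap.lTensor_inj_iff_rTensor_inj]
  obtain ⟨z, hz⟩ : ∃ z, z = (Submodule.inclusion F.le_torsionClosure).rTensor (∀ i, N i) x :=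
    ⟨_, rfl⟩
  have hzx : P.subtype.rTensor (∀ i, N i) z = F.subtype.rTensor (∀ i, N i) x := by
    rw [hz, ← LinearMap.rTensor_comp_apply, Submodule.subtype_comp_inclusion]
  have hz0 : piRightHom R R P N z = 0 := by
    funext i
    apply hinj (N i)
    rw [← TensorProduct.piRightHom_rTensor, hzx, hx, Pi.zero_apply, Pi.zero_apply, map_zero]
  have hz' : z = 0 := by
    rw [TensorProduct.eq_sum_tmul_lid_rTensor hb z]
    refine Finset.sum_eq_zero fun k _ => ?_
    have : TensorProduct.lid R _ ((φ k).rTensor (∀ i, N i) z) = 0 := by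
      funext i
      rw [TensorProduct.lid_rTensor_apply_pi, hz0, Pi.zero_apply, map_zero, map_zero,
        Pi.zero_apply]
    rw [this, TensorProduct.tmul_zero]
  rw [← hzx, hz', map_zero]

end Dedekind

/-! ### Projectivity of countably generated submodules -/

/-- A module which is the union of a chain starting at zero whose successive extensions are split
by projective modules is projective. -/
theorem Module.Projective.of_chain {R : Type u} [CommRing R] {A : Type v} [AddCommGroup A]
    [Module R A] (P : ℕ → Submodule R A) (hP : Monotone P) (h0 : P 0 = ⊥)
    (htop : ∀ a, ∃ n, a ∈ P n) (Q : ℕ → Type v) [∀ n, AddCommGroup (Q n)] [∀ n, Module R (Q n)]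
    [∀ n, Module.Projective R (Q n)] (f : ∀ n, Q n →ₗ[R] A)
    (hf : ∀ n x, f n x ∈ P (n + 1)) (hf0 : ∀ n x, f n x ∈ P n → x = 0)
    (hfP : ∀ n, P (n + 1) ≤ P n ⊔ LinearMap.range (f n)) : Module.Projective R A := by
  classical
  let g : (⨁ n, Q n) →ₗ[R] A := DirectSum.toModule R ℕ A f
  have hg (n : ℕ) (x : Q n) : g (DirectSum.lof R ℕ Q n x) = f n x :=
    DirectSum.toModule_lof R n x
  have hsurj : Function.Surjective g := by
    rw [← LinearMap.range_eq_top, eq_top_iff]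
    have : ∀ n, P n ≤ LinearMap.range g := by
      intro n
      induction n with
      | zero => simp [h0]
      | succ n ih =>
        refine (hfP n).trans (sup_le ih ?_)
        rintro _ ⟨x, rfl⟩
        exact ⟨_, hg n x⟩
    intro a _
    obtain ⟨n, hn⟩ := htop a
    exact this n hn
  have hinj : Function.Injective g := by
    rw [injective_iff_map_eq_zero]
    intro x hx
    by_contra hne
    have hs : (DFinsupp.support x).Nonempty := by
      rwa [Finset.nonempty_iff_ne_empty, Ne, DFinsupp.support_eq_empty]
    set m := (DFinsupp.support x).max' hs
    -- In a relation, the term of top index `m` is minus a sum of earlier terms, so it lies in `P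
    -- m`.
    have hm : m ∈ DFinsupp.support x := Finset.max'_mem _ hs
    have hsum : g x = ∑ n ∈ DFinsupp.support x, f n (x n) := by
      conv_lhs => rw [← DirectSum.sum_support_of x, map_sum]
      exact Finset.sum_congr rfl fun n _ => hg n (x n)
    rw [hx, ← Finset.add_sum_erase _ _ hm] at hsum
    have hmem : f m (x m) ∈ P m := by
      rw [eq_neg_of_add_eq_zero_left hsum.symm]
      refine (P m).neg_mem ((P m).sum_mem fun n hn => ?_)
      rw [Finset.mem_erase] at hn
      have hlt : n < m := lt_of_le_of_ne (Finset.le_max' _ _ hn.2) hn.1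
      exact hP (Nat.succ_le_of_lt hlt) (hf n _)
    exact (DFinsupp.mem_support_iff.1 hm) (hf0 m _ hmem)
  exact Module.Projective.of_equiv' (LinearEquiv.ofBijective g ⟨hinj, hsurj⟩)

section Dedekind

variable {R : Type u} [CommRing R] [IsDedekindDomain R] {M : Type v} [AddCommGroup M] [Module R M]

theorem HasFGTorsionClosures.submodule (h : HasFGTorsionClosures R M) (C : Submodule R M) :
    HasFGTorsionClosures R C := by
  intro F hF
  refine Submodule.fg_of_fg_map_injective C.subtype C.subtype_injective ?_
  refine Submodule.FG.of_le (h _ (hF.map C.subtype)) ?_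
  rintro _ ⟨m, ⟨r, hr, hm⟩, rfl⟩
  exact ⟨r, hr, r • m, hm, rfl⟩

theorem HasFGTorsionClosures.projective_of_countable [Module.IsTorsionFree R M]
    (h : HasFGTorsionClosures R M) {s : ℕ → M} (hs : Submodule.span R (Set.range s) = ⊤) :
    Module.Projective R M := by
  let S (n : ℕ) : Submodule R M := Submodule.span R (s '' Set.Iio n)
  let P (n : ℕ) : Submodule R M := (S n).torsionClosure
  have hSmono : Monotone S := fun a b hab =>
    Submodule.span_mono (Set.image_mono (Set.Iio_subset_Iio hab))
  have hmono : Monotone P := fun a b hab => Submodule.torsionClosure_mono (hSmono hab)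
  have hfg (n : ℕ) : Module.Finite R (P n) :=
    Module.Finite.iff_fg.2 (h _ (Submodule.fg_span ((Set.finite_Iio n).image s)))
  let Q (n : ℕ) := P (n + 1) ⧸ (P n).submoduleOf (P (n + 1))
  have hQ (n : ℕ) : Module.Projective R (Q n) := by
    have : Module.IsTorsionFree R (Q n) :=
      Submodule.isTorsionFree_quotient_of_smul_mem fun r m hr hm =>
        Submodule.mem_torsionClosure_of_smul_mem hr hm
    exact Module.projective_of_finite_of_isTorsionFree
  have ht (n : ℕ) : ∃ t : Q n →ₗ[R] P (n + 1), ((P n).submoduleOf (P (n + 1))).mkQ ∘ₗ t = .id :=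
    LinearMap.exists_rightInverse_of_surjective _ (Submodule.range_mkQ _)
  choose t ht using ht
  have ht' (n : ℕ) (x : Q n) : ((P n).submoduleOf (P (n + 1))).mkQ (t n x) = x :=
    LinearMap.congr_fun (ht n) x
  refine Module.Projective.of_chain P hmono ?_ ?_ Q (fun n => (P (n + 1)).subtype ∘ₗ t n)
    (fun n x => (t n x).2) ?_ ?_
  · simp [P, S, Submodule.torsionClosure_bot]
  · intro a
    have ha : a ∈ ⨆ n, S n := by
      have : (⊤ : Submodule R M) ≤ ⨆ n, S n := by
        rw [← hs, Submodule.span_le]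
        rintro _ ⟨n, rfl⟩
        exact Submodule.mem_iSup_of_mem (n + 1)
          (Submodule.subset_span ⟨n, Nat.lt_succ_self n, rfl⟩)
      exact this trivial
    rw [Submodule.mem_iSup_of_directed _ hSmono.directed_le] at ha
    obtain ⟨n, hn⟩ := ha
    exact ⟨n, Submodule.le_torsionClosure hn⟩
  · intro n x hx
    rw [← ht' n x, Submodule.mkQ_apply, Submodule.Quotient.mk_eq_zero]
    exact hx
  · intro n a ha
    have hd : (⟨a, ha⟩ : P (n + 1)) - t n (((P n).submoduleOf (P (n + 1))).mkQ ⟨a, ha⟩) ∈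
        (P n).submoduleOf (P (n + 1)) := by
      rw [← Submodule.Quotient.mk_eq_zero, ← Submodule.mkQ_apply, map_sub, ht', sub_self]
    rw [Submodule.mem_sup]
    exact ⟨_, hd, _, ⟨_, rfl⟩, sub_add_cancel _ _⟩

theorem HasFGTorsionClosures.isAlephOneProjective [Module.IsTorsionFree R M]
    (h : HasFGTorsionClosures R M) : IsAlephOneProjective R M := by
  rintro C ⟨s, hs, rfl⟩
  -- Adding `0` makes the set nonempty, so it can be enumerated by `ℕ`.
  have hs' : (insert 0 s).Countable := hs.insert 0
  obtain ⟨f, hf⟩ := hs'.exists_eq_range (Set.insert_nonempty 0 s)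
  have hspan : Submodule.span R (Set.range f) = Submodule.span R s := by
    rw [← hf, Submodule.span_insert_zero]
  rw [← hspan]
  refine (h.submodule _).projective_of_countable
    (s := fun n => ⟨f n, Submodule.subset_span ⟨n, rfl⟩⟩) ?_
  apply Submodule.map_injective_of_injective (Submodule.subtype_injective _)
  rw [Submodule.map_span, Submodule.map_top, Submodule.range_subtype, ← Set.range_comp]
  rfl

/-! ### Countable spectrum and `ℵ₁`-projective modules -/

omit [IsDedekindDomain R] in
theorem IsAlephOneProjective.isTorsionFree [IsDomain R] (h : IsAlephOneProjective R M) :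
    Module.IsTorsionFree R M := by
  rw [Module.isTorsionFree_iff_smul_eq_zero]
  intro r m hm
  have := h (Submodule.span R {m}) ⟨{m}, Set.countable_singleton m, rfl⟩
  let x : Submodule.span R {m} := ⟨m, Submodule.mem_span_singleton_self m⟩
  have hx : r • x = 0 := Subtype.ext hm
  rcases smul_eq_zero.1 hx with h | h
  · exact Or.inl h
  · exact Or.inr (congrArg Subtype.val h)

theorem countable_ideal [Countable (PrimeSpectrum R)] : Countable (Ideal R) := by
  -- Unique factorization of ideals; `none` encodes the zero ideal.
  have : ∀ I : Ideal R, ∃ s : Option (Multiset (PrimeSpectrum R)),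
      s.elim ⊥ (fun s => (s.map PrimeSpectrum.asIdeal).prod) = I := by
    intro I
    induction I using UniqueFactorizationMonoid.induction_on_prime with
    | h₁ => exact ⟨none, rfl⟩
    | h₂ x hx => exact ⟨some 0, by simpa using (Ideal.isUnit_iff.1 hx).symm⟩
    | h₃ a p ha hp ih =>
      obtain ⟨s, rfl⟩ := ih
      cases s with
      | none => exact absurd rfl ha
      | some s =>
        refine ⟨some (⟨p, Ideal.isPrime_of_prime hp⟩ ::ₘ s), ?_⟩
        simp
  have hc : Countable (Multiset (PrimeSpectrum R)) := by
    classical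
    exact Multiset.toFinsupp.injective.countable
  exact Function.Surjective.countable (f := fun s : Option (Multiset (PrimeSpectrum R)) =>
    s.elim (⊥ : Ideal R) (fun s => (s.map PrimeSpectrum.asIdeal).prod)) this

/-- The closure is the union of the submodules `S I = {m | I m ⊆ F}` over the countably many nonzero
ideals `I`. Each is finitely generated, since a nonzero `r ∈ I` embeds it into `F` by
multiplication. -/
theorem Submodule.isCountablyGeneratedSubmodule_torsionClosure [Countable (PrimeSpectrum R)]
    [Module.IsTorsionFree R M] {F : Submodule R M} (hF : F.FG) :
    IsCountablyGeneratedSubmodule F.torsionClosure := by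
  have := countable_ideal (R := R)
  let S (I : Ideal R) : Submodule R M := ⨅ r ∈ I, F.comap (LinearMap.lsmul R M r)
  have hS (I : Ideal R) (m : M) : m ∈ S I ↔ ∀ r ∈ I, r • m ∈ F := by
    simp [S]
  have hfg (I : {I : Ideal R // I ≠ ⊥}) : (S I).FG := by
    obtain ⟨r, hrI, hr⟩ := Submodule.exists_mem_ne_zero_of_ne_bot I.2
    refine Submodule.fg_of_fg_map_injective (LinearMap.lsmul R M r) (smul_right_injective M hr) ?_
    refine Submodule.FG.of_le hF ?_
    rintro _ ⟨m, hm, rfl⟩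
    exact (hS _ _).1 hm r hrI
  choose s hs using hfg
  refine ⟨⋃ I, s I, Set.countable_iUnion fun I => (s I).countable_toSet, ?_⟩
  rw [Submodule.span_iUnion]
  simp only [hs]
  apply le_antisymm
  · refine iSup_le fun I m hm => ?_
    obtain ⟨r, hrI, hr⟩ := Submodule.exists_mem_ne_zero_of_ne_bot I.2
    exact ⟨r, hr, (hS _ _).1 hm r hrI⟩
  · rintro m ⟨r, hr, hm⟩
    refine Submodule.mem_iSup_of_mem ⟨Ideal.span {r}, by simpa using hr⟩ ?_
    rw [hS]
    intro c hc
    obtain ⟨d, rfl⟩ := Ideal.mem_span_singleton'.1 hc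
    rw [mul_smul]
    exact F.smul_mem _ hm

/-- A projective module which is torsion modulo a finitely generated submodule embeds into a free
module of finite rank. -/
theorem Module.Projective.finite_of_torsionClosure_eq_top [Module.Projective R M]
    {F : Submodule R M} (hF : F.FG) (h : F.torsionClosure = ⊤) : Module.Finite R M := by
  obtain ⟨s, hs⟩ := Module.Projective.out (R := R) (P := M)
  obtain ⟨t, rfl⟩ := hF
  classical
  let T : Set M := ↑(t.biUnion fun x => (s x).support)
  have hT (m : M) : s m ∈ Finsupp.supported R R T := by
    have hF : Submodule.span R (t : Set M) ≤ (Finsupp.supported R R T).comap s := by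
      rw [Submodule.span_le]
      intro x hx
      change s x ∈ Finsupp.supported R R T
      rw [Finsupp.mem_supported]
      exact Finset.coe_subset.2 (Finset.subset_biUnion_of_mem (fun x => (s x).support) hx)
    -- Over a domain, `s m` and `r • s m` have the same support.
    obtain ⟨r, hr, hm⟩ : m ∈ (Submodule.span R (t : Set M)).torsionClosure := h ▸ trivial
    have := hF hm
    rw [Submodule.mem_comap, map_smul, Finsupp.mem_supported, Finsupp.support_smul_eq hr] at this
    exact this
  have : Finite T := Finset.finite_toSet _
  have : IsNoetherian R (Finsupp.supported R R T) :=
    isNoetherian_of_linearEquiv (Finsupp.supportedEquivFinsupp T).symm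
  exact Module.Finite.of_injective (s.codRestrict _ hT)
    (fun a b hab => hs.injective (congrArg Subtype.val hab))

theorem IsAlephOneProjective.hasFGTorsionClosures [Countable (PrimeSpectrum R)]
    (h : IsAlephOneProjective R M) : HasFGTorsionClosures R M := by
  have := h.isTorsionFree
  intro F hF
  have := h _ (F.isCountablyGeneratedSubmodule_torsionClosure hF)
  rw [← Module.Finite.iff_fg]
  refine Module.Projective.finite_of_torsionClosure_eq_top
    (F := F.comap F.torsionClosure.subtype) ?_ ?_
  · refine Submodule.fg_of_fg_map_injective _ F.torsionClosure.subtype_injective ?_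
    rwa [Submodule.map_comap_subtype, inf_eq_right.2 F.le_torsionClosure]
  · rw [eq_top_iff]
    rintro ⟨m, r, hr, hm⟩ -
    exact ⟨r, hr, hm⟩

end Dedekind

theorem mainTheorem10 (R : Type u) [CommRing R] [IsDedekindDomain R]
    [Countable (PrimeSpectrum R)] (M : Type v) [AddCommGroup M] [Module R M] :
    IsFlatMittagLefflerModule.{u, v, w} R M ↔ IsAlephOneProjective R M := by
  constructor
  · rintro ⟨_, h⟩
    exact (hasFGTorsionClosures_of_isMittagLefflerModule h).isAlephOneProjective
  · intro h
    have := h.isTorsionFree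
    exact ⟨inferInstance, isMittagLefflerModule_of_hasFGTorsionClosures h.hasFGTorsionClosures⟩
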